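/- Let $X$ be a complex Banach space, $B_r=\{x\in X:\|x\|<r\}$ and $\mathbb B=B_1$. For $x\in X\setminus\{0\}$ let $T(x)$ be the set of continuous linear functionals $l_x:X\to\mathbb C$ with $l_x(x)=\|x\|$ and $\|l_x\|=1$. For a holomorphic mapping $F:\mathbb B\to X$ put $$\|F\|_{\mathcal B}=\|F(0)\|+\sup_{x\in\mathbb B\setminus\{0\}}(1-\|x\|^2)\frac{\|DF(x)x\|}{\|x\|},$$ and let $\mathcal B_1(X)$ be the class of all $F:\mathbb B\to X$ of the form $F(x)=f(x)x$ with $f:\mathbb B\to\mathbb C$ holomorphic, $f(0)=1$ and $\|F\|_{\mathcal B}=1$. For $a\in\mathbb B$, a schlicht ball of $F$ centered at $F(a)$ is an open ball with center $F(a)$ and positive radius onto which $F$ maps some open subset of $\mathbb B$ containing $a$ biholomorphically. Let $r(a;F)\in[0,\infty]$ be the supremum of the radii of such balls ($0$ if there are none), $r(F)=\sup_{a\in\mathbb B}r(a;F)$ and $\mathbf B^*_X=\inf\{r(F):F\in\mathcal B_1(X)\}$ (with $\inf\emptyset=\infty$; the class is empty only for $X=\{0\}$). Then: (i) For every $F\in\mathcal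 B_1(X)$, every $x$ with $0<\|x\|\le 1/\sqrt3$ and every $l_x\in T(x)$, $$\operatorname{Re} l_x(DF(x)x)\ \ge\ \frac{1-\sqrt3\,\|x\|}{\left(1-\frac{1}{\sqrt3}\|x\|\right)^3}\,\|x\|.$$ (ii) $\mathbf B^*_X\ge\frac{\sqrt3}{4}$. Moreover, every $F\in\mathcal B_1(X)$ maps $B_{1/\sqrt3}$ biholomorphically onto the open set $F(B_{1/\sqrt3})$, and $F(B_{1/\sqrt3})\supseteq B_{\sqrt3/4}$. -/

import Mathlib

open Metric Set
open scoped ENNReal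

noncomputable section

/-- `F` maps the open set `U` biholomorphically onto the open set `V`: `F` is holomorphic on `U`
and has a holomorphic two-sided inverse `G : V → U`. -/
def IsBiholomorphicOn {X Y : Type*} [NormedAddCommGroup X] [NormedSpace ℂ X]
    [NormedAddCommGroup Y] [NormedSpace ℂ Y] (F : X → Y) (U : Set X) (V : Set Y) : Prop :=
  IsOpen U ∧ IsOpen V ∧ DifferentiableOn ℂ F U ∧ MapsTo F U V ∧
    ∃ G : Y → X, DifferentiableOn ℂ G V ∧ MapsTo G V U ∧ LeftInvOn G F U ∧ RightInvOn G F V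

/-- The set `T(x)` of support functionals at `x` (used for `x ≠ 0`): continuous complex linear
functionals `l` with `l x = ‖x‖` and `‖l‖ = 1`. -/
def supportFunctionals {X : Type*} [NormedAddCommGroup X] [NormedSpace ℂ X] (x : X) :
    Set (X →L[ℂ] ℂ) :=
  {l | l x = (‖x‖ : ℂ) ∧ ‖l‖ = 1}

/-- The ball with centre `F a` and radius `r > 0` is a schlicht ball of `F` (a mapping on the open
unit ball): some open subset of the unit ball containing `a` is mapped biholomorphically onto it. -/
def IsSchlichtBall {X : Type*} [NormedAddCommGroup X] [NormedSpace ℂ X]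
    (F : X → X) (a : X) (r : ℝ) : Prop :=
  0 < r ∧ ∃ U : Set X, IsOpen U ∧ U ⊆ ball 0 1 ∧ a ∈ U ∧ IsBiholomorphicOn F U (ball (F a) r)

/-- `r(a; F)`: the supremum of the radii of the schlicht balls of `F` centred at `F a`
(`0` if there is none). -/
def schlichtRadiusAt {X : Type*} [NormedAddCommGroup X] [NormedSpace ℂ X]
    (F : X → X) (a : X) : ℝ≥0∞ :=
  ⨆ (r : ℝ) (_ : IsSchlichtBall F a r), ENNReal.ofReal r

/-- `r(F)`: the supremum of `r(a; F)` over `a` in the open unit ball. -/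
def schlichtRadius {X : Type*} [NormedAddCommGroup X] [NormedSpace ℂ X]
    (F : X → X) : ℝ≥0∞ :=
  ⨆ a ∈ ball (0 : X) 1, schlichtRadiusAt F a

/-- The Bloch norm
`‖F‖ = ‖F 0‖ + sup {(1 - ‖x‖ ^ 2) * ‖DF(x) x‖ / ‖x‖ : 0 < ‖x‖ < 1}`, possibly infinite. -/
def blochNorm {X : Type*} [NormedAddCommGroup X] [NormedSpace ℂ X] (F : X → X) : ℝ≥0∞ :=
  ENNReal.ofReal ‖F 0‖ +
    ⨆ x ∈ ball (0 : X) 1 \ {0}, ENNReal.ofReal ((1 - ‖x‖ ^ 2) * (‖fderiv ℂ F x x‖ / ‖x‖))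

/-- The class of mappings of the form `F x = f x • x` on the open unit ball, with `f` holomorphic
there, `f 0 = 1`, and Bloch norm `1`. (Values of `F` and `f` off the unit ball are irrelevant.) -/
def blochClass (X : Type*) [NormedAddCommGroup X] [NormedSpace ℂ X] : Set (X → X) :=
  {F | (∃ f : X → ℂ, DifferentiableOn ℂ f (ball 0 1) ∧ f 0 = 1 ∧
      ∀ x ∈ ball (0 : X) 1, F x = f x • x) ∧ blochNorm F = 1}

/-- The Bloch constant of the class: the infimum of `r(F)`. -/
def blochConstant (X : Type*) [NormedAddCommGroup X] [NormedSpace ℂ X] : ℝ≥0∞ :=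
  ⨅ F ∈ blochClass X, schlichtRadius F

end

/-!
Write `F x = f x • x`. Then `DF(x) x = (f x + Df(x) x) • x`, and `F` maps every complex line `ℂ u`,
`‖u‖ = 1`, into itself, acting there as `g z = z * f (z • u)`. The derivative `h = g'` is
`f (z • u) + Df(z • u)(z • u)`, so the Bloch norm says exactly that `(1 - |z|²) |h z| ≤ 1`, while
`h 0 = 1`. The distortion estimate is therefore Bonk's theorem for `h` (`bonk_distortion`).

Bonk's theorem is a boundary Schwarz lemma. The substitution `ψ s = √3 (1 - s) / (3 - s)` carries the
unit disc to a disc that has `0 = ψ 1` on its boundary, and `q s = 4 h (ψ s) / (3 - s)²` satisfies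
`|q s| ≤ 2 / (3 - |s|²) ≤ 1` and `q 1 = 1`. As `|h t|² (1 - t²)²` is maximal at `t = 0`, the
derivative of `|q|²` at `1` is `2`, as for the identity, so Julia's lemma
(`le_re_of_boundary_deriv`) gives `Re q x ≥ x` on `(-1, 1)`, which is the claim after undoing the
substitution.

On the disc of radius `1 / √3` the lower bound is positive, so `g` is injective there
(`injOn_of_re_deriv_pos`), and integrating it along radii gives `|g z| ≥ G |z|` with
`G (1 / √3) = √3 / 4`, so `g` covers the disc of radius `√3 / 4`
(`ball_subset_image_of_bonk_bound`). Distinct lines meet only in `0` and `f` has no zero in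
`ball 0 (1 / √3)`, so injectivity and covering pass from the slices to `F`. Finally `DF(x)` is the
rank-one perturbation `f x • id + Df(x) ⊗ x` of a multiple of the identity, invertible because
neither `f x` nor `f x + Df(x) x` vanishes; a Fréchet differentiable map on an open set is `C¹`
(`continuousAt_fderiv_of_differentiableOn`), and the inverse function theorem makes the inverse
holomorphic (`isBiholomorphicOn_image`).
-/

open Filter Topology ComplexConjugate

/-! ### The Schwarz–Pick inequality and a boundary version of it -/

theorem norm_one_sub_conj_mul_sq (a b : ℂ) :
    ‖1 - conj a * b‖ ^ 2 = ‖b - a‖ ^ 2 + (1 - ‖a‖ ^ 2) * (1 - ‖b‖ ^ 2) := by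
  simp only [← Complex.normSq_eq_norm_sq, Complex.normSq_apply, Complex.sub_re, Complex.sub_im,
    Complex.mul_re, Complex.mul_im, Complex.conj_re, Complex.conj_im, Complex.one_re,
    Complex.one_im]
  ring

theorem one_sub_conj_mul_ne_zero {a b : ℂ} (ha : ‖a‖ < 1) (hb : ‖b‖ < 1) :
    1 - conj a * b ≠ 0 := by
  intro h
  have h1 : ‖conj a * b‖ = 1 := by rw [← sub_eq_zero.1 h, norm_one]
  rw [norm_mul, RCLike.norm_conj] at h1
  nlinarith [norm_nonneg a, norm_nonneg b]

/-- The automorphism of the unit disc that sends `a` to `0`, with inverse `discAut (-a)`. -/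
noncomputable def discAut (a w : ℂ) : ℂ := (w - a) / (1 - conj a * w)

theorem norm_discAut_lt_one {a w : ℂ} (ha : ‖a‖ < 1) (hw : ‖w‖ < 1) : ‖discAut a w‖ < 1 := by
  have hne := norm_pos_iff.2 (one_sub_conj_mul_ne_zero ha hw)
  rw [discAut, norm_div, div_lt_one hne]
  refine lt_of_pow_lt_pow_left₀ 2 hne.le ?_
  rw [norm_one_sub_conj_mul_sq]
  have h1 : 0 < 1 - ‖a‖ ^ 2 := by nlinarith [norm_nonneg a]
  have h2 : 0 < 1 - ‖w‖ ^ 2 := by nlinarith [norm_nonneg w]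
  linarith [mul_pos h1 h2]

theorem mapsTo_discAut {a : ℂ} (ha : ‖a‖ < 1) : MapsTo (discAut a) (ball 0 1) (ball 0 1) := by
  intro w hw
  rw [mem_ball_zero_iff] at hw ⊢
  exact norm_discAut_lt_one ha hw

theorem differentiableOn_discAut {a : ℂ} (ha : ‖a‖ < 1) :
    DifferentiableOn ℂ (discAut a) (ball 0 1) := by
  intro w hw
  have := one_sub_conj_mul_ne_zero ha (mem_ball_zero_iff.1 hw)
  exact ((differentiableAt_id.sub_const a).div
    ((differentiableAt_const _).sub (differentiableAt_id.const_mul _)) this).differentiableWithinAt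

theorem discAut_neg_discAut {a b : ℂ} (ha : ‖a‖ < 1) (hb : ‖b‖ < 1) :
    discAut (-a) (discAut a b) = b := by
  have h1 := one_sub_conj_mul_ne_zero ha hb
  have h2 := one_sub_conj_mul_ne_zero ha ha
  have e1 : discAut a b - -a = b * (1 - conj a * a) / (1 - conj a * b) := by
    rw [discAut, eq_div_iff h1, sub_mul, div_mul_cancel₀ _ h1]
    ring
  have e2 : 1 - conj (-a) * discAut a b = (1 - conj a * a) / (1 - conj a * b) := by
    rw [discAut, eq_div_iff h1, sub_mul, mul_assoc, div_mul_cancel₀ _ h1, map_neg]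
    ring
  rw [discAut, e1, e2, div_div_div_cancel_right₀ h1, mul_div_assoc, div_self h2, mul_one]

/-- The **Schwarz–Pick inequality** in a form free of quotients. -/
theorem schwarz_pick {q : ℂ → ℂ} (hd : DifferentiableOn ℂ q (ball 0 1))
    (hm : MapsTo q (ball 0 1) (ball 0 1)) {a b : ℂ} (ha : ‖a‖ < 1) (hb : ‖b‖ < 1) :
    ‖1 - conj (q a) * q b‖ ^ 2 * ((1 - ‖a‖ ^ 2) * (1 - ‖b‖ ^ 2)) ≤
      (1 - ‖q a‖ ^ 2) * (1 - ‖q b‖ ^ 2) * ‖1 - conj a * b‖ ^ 2 := by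
  have hqa : ‖q a‖ < 1 := mem_ball_zero_iff.1 (hm (mem_ball_zero_iff.2 ha))
  have hqb : ‖q b‖ < 1 := mem_ball_zero_iff.1 (hm (mem_ball_zero_iff.2 hb))
  have hna : ‖-a‖ < 1 := by rwa [norm_neg]
  have hS : ‖(discAut (q a) ∘ q ∘ discAut (-a)) (discAut a b)‖ ≤ ‖discAut a b‖ := by
    have hm' := (mapsTo_discAut hqa).comp (hm.comp (mapsTo_discAut hna))
    refine Complex.norm_le_norm_of_mapsTo_ball (R := 1) ?_
      (hm'.mono_right ball_subset_closedBall) ?_ (norm_discAut_lt_one ha hb)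
    · exact (differentiableOn_discAut hqa).comp (hd.comp (differentiableOn_discAut hna)
        (mapsTo_discAut hna)) (hm.comp (mapsTo_discAut hna))
    · simp [discAut]
  simp only [Function.comp_apply, discAut_neg_discAut ha hb] at hS
  have h1 := norm_pos_iff.2 (one_sub_conj_mul_ne_zero ha hb)
  have h2 := norm_pos_iff.2 (one_sub_conj_mul_ne_zero hqa hqb)
  simp only [discAut, norm_div] at hS
  rw [div_le_div_iff₀ h2 h1] at hS
  have hS2 := pow_le_pow_left₀ (by positivity) hS 2
  rw [mul_pow, mul_pow] at hS2
  have e1 := norm_one_sub_conj_mul_sq a b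
  have e2 := norm_one_sub_conj_mul_sq (q a) (q b)
  have e3 : (1 - ‖a‖ ^ 2) * (1 - ‖b‖ ^ 2) = ‖1 - conj a * b‖ ^ 2 - ‖b - a‖ ^ 2 := by linarith
  have e4 : (1 - ‖q a‖ ^ 2) * (1 - ‖q b‖ ^ 2)
    = ‖1 - conj (q a) * q b‖ ^ 2 - ‖q b - q a‖ ^ 2 := by linarith
  rw [e3, e4]
  linarith

/-- **Julia's lemma** on the real diameter, for angular derivative `1` at the boundary fixed
point `1`: the image of `x` lies in the horodisc at `1` with diameter `[x, 1]`. -/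
theorem le_re_of_boundary_deriv {q : ℂ → ℂ} (hd : DifferentiableOn ℂ q (ball 0 1))
    (hm : MapsTo q (ball 0 1) (ball 0 1)) (h1 : q 1 = 1) (hc : ContinuousAt q 1)
    (hder : HasDerivAt (fun r : ℝ ↦ ‖q r‖ ^ 2) 2 1) {x : ℝ} (hx : x ∈ Ioo (-1) 1) :
    x ≤ (q x).re := by
  have hxn : ‖(x : ℂ)‖ < 1 := by
    rw [Complex.norm_real, Real.norm_eq_abs, abs_lt]; exact hx
  have hqx : ‖q x‖ < 1 := mem_ball_zero_iff.1 (hm (mem_ball_zero_iff.2 hxn))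
  have hslope := (hasDerivAt_iff_tendsto_slope.1 hder).mono_left
    (nhdsWithin_mono _ (fun r (hr : r < 1) ↦ hr.ne))
  have hcr : Tendsto (fun r : ℝ ↦ q r) (𝓝[<] 1) (𝓝 1) := by
    have : ContinuousAt (fun r : ℝ ↦ q r) 1 :=
      ContinuousAt.comp (f := fun r : ℝ ↦ (r : ℂ)) (by simpa using hc)
        Complex.continuous_ofReal.continuousAt
    have h := this.tendsto.mono_left (nhdsWithin_le_nhds (s := Iio 1))
    simpa [h1] using h
  have hid : Tendsto (fun r : ℝ ↦ r) (𝓝[<] 1) (𝓝 1) := tendsto_id.mono_left nhdsWithin_le_nhds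
  -- Divide the Schwarz–Pick inequality for the points `r` and `x` by `1 - r` and let `r → 1`.
  have key : ‖1 - conj (1 : ℂ) * q x‖ ^ 2 * ((1 + 1) * (1 - x ^ 2)) ≤
      2 * (1 - ‖q x‖ ^ 2) * (1 - 1 * x) ^ 2 := by
    refine le_of_tendsto_of_tendsto (b := 𝓝[<] (1 : ℝ))
      (f := fun r : ℝ ↦ ‖1 - conj (q r) * q x‖ ^ 2 * ((1 + r) * (1 - x ^ 2)))
      (g := fun r : ℝ ↦ slope (fun r : ℝ ↦ ‖q r‖ ^ 2) 1 r * (1 - ‖q x‖ ^ 2) * (1 - r * x) ^ 2)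
      ?_ ?_ ?_
    · refine Tendsto.mul ?_ ?_
      · have : Tendsto (fun r : ℝ ↦ conj (q r)) (𝓝[<] 1) (𝓝 (conj 1)) :=
          (Complex.continuous_conj.tendsto _).comp hcr
        exact ((tendsto_const_nhds.sub (this.mul_const _)).norm).pow 2
      · exact (tendsto_const_nhds.add hid).mul_const _
    · exact (hslope.mul_const _).mul ((tendsto_const_nhds.sub (hid.mul_const _)).pow 2)
    · filter_upwards [Ioo_mem_nhdsLT (show (-1 : ℝ) < 1 by norm_num)] with r hr
      have hrn : ‖(r : ℂ)‖ < 1 := by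
        rw [Complex.norm_real, Real.norm_eq_abs, abs_lt]; exact hr
      have hsp := schwarz_pick hd hm hrn hxn
      have er : ‖(r : ℂ)‖ ^ 2 = r ^ 2 := by rw [Complex.norm_real, Real.norm_eq_abs, sq_abs]
      have ex : ‖(x : ℂ)‖ ^ 2 = x ^ 2 := by rw [Complex.norm_real, Real.norm_eq_abs, sq_abs]
      have erx : ‖1 - conj (r : ℂ) * x‖ ^ 2 = (1 - r * x) ^ 2 := by
        rw [Complex.conj_ofReal, ← Complex.ofReal_mul, ← Complex.ofReal_one, ← Complex.ofReal_sub,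
          Complex.norm_real, Real.norm_eq_abs, sq_abs]
      rw [er, ex, erx] at hsp
      have hr1 : 0 < 1 - r := by linarith [hr.2]
      have hsl : slope (fun r : ℝ ↦ ‖q r‖ ^ 2) 1 r = (1 - ‖q r‖ ^ 2) / (1 - r) := by
        rw [slope_def_field, ← neg_div_neg_eq]
        simp [h1]
      change _ * _ ≤ _
      rw [hsl, div_mul_eq_mul_div, div_mul_eq_mul_div, le_div_iff₀ hr1]
      linarith
  have hre : ‖1 - conj (1 : ℂ) * q x‖ ^ 2 = 1 - 2 * (q x).re + ‖q x‖ ^ 2 := by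
    simp only [map_one, one_mul, ← Complex.normSq_eq_norm_sq, Complex.normSq_apply, Complex.sub_re,
      Complex.sub_im, Complex.one_re, Complex.one_im]
    ring
  have hre2 : (q x).re ^ 2 ≤ ‖q x‖ ^ 2 := by
    rw [← sq_abs]; exact pow_le_pow_left₀ (abs_nonneg _) (Complex.abs_re_le_norm _) 2
  have hlt : (q x).re < 1 := (Complex.re_le_norm _).trans_lt hqx
  rw [hre] at key
  have hx1 : 0 < 1 - x := by linarith [hx.2]
  have key2 : (1 - 2 * (q x).re + ‖q x‖ ^ 2) * (1 + x) ≤ (1 - ‖q x‖ ^ 2) * (1 - x) := by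
    refine le_of_mul_le_mul_left ?_ (mul_pos two_pos hx1)
    linarith
  have : (1 - (q x).re) * (x - (q x).re) ≤ 0 := by nlinarith
  nlinarith

/-! ### Bonk's distortion theorem -/

/-- The bound `‖h z‖ ≤ (1 - ‖z‖ ^ 2)⁻¹` is attained at `0`, so `‖h t‖ ^ 2 * (1 - t ^ 2) ^ 2` is
maximal, hence stationary, at `t = 0`; so is `‖h t‖ ^ 2`. -/
theorem hasDerivAt_norm_sq_zero {h : ℂ → ℂ} (hd : DifferentiableOn ℂ h (ball 0 1)) (h0 : h 0 = 1)
    (hb : ∀ z ∈ ball (0 : ℂ) 1, (1 - ‖z‖ ^ 2) * ‖h z‖ ≤ 1) :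
    HasDerivAt (fun t : ℝ ↦ ‖h t‖ ^ 2) 0 0 := by
  have hdiff : DifferentiableAt ℂ h ((0 : ℝ) : ℂ) := by
    simpa using hd.differentiableAt (ball_mem_nhds (0 : ℂ) one_pos)
  obtain ⟨d, hν⟩ : ∃ d, HasDerivAt (fun t : ℝ ↦ ‖h t‖ ^ 2) d 0 :=
    ⟨_, hdiff.hasDerivAt.comp_ofReal.norm_sq⟩
  have hw : HasDerivAt (fun t : ℝ ↦ (1 - t ^ 2) ^ 2) 0 0 := by
    have := (((hasDerivAt_id (0 : ℝ)).pow 2).const_sub 1).pow 2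
    convert! this using 1
    simp
  have hprod := hν.mul hw
  have hmax : IsLocalMax ((fun t : ℝ ↦ ‖h t‖ ^ 2) * fun t : ℝ ↦ (1 - t ^ 2) ^ 2) 0 := by
    filter_upwards [Ioo_mem_nhds (show (-1 : ℝ) < 0 by norm_num) one_pos] with t ht
    have htn : ‖(t : ℂ)‖ < 1 := by
      rw [Complex.norm_real, Real.norm_eq_abs, abs_lt]; exact ht
    have hbt := hb t (mem_ball_zero_iff.2 htn)
    have et : ‖(t : ℂ)‖ ^ 2 = t ^ 2 := by rw [Complex.norm_real, Real.norm_eq_abs, sq_abs]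
    rw [et] at hbt
    have h1 : 0 ≤ 1 - t ^ 2 := by nlinarith [ht.1, ht.2]
    have := pow_le_pow_left₀ (by positivity) hbt 2
    simp only [Pi.mul_apply, Complex.ofReal_zero, h0, norm_one]
    nlinarith
  have hz := hmax.hasDerivAt_eq_zero hprod
  simp only [ne_eq, OfNat.ofNat_ne_zero, not_false_eq_true, zero_pow, sub_zero, one_pow, mul_one,
    mul_zero, add_zero] at hz
  rwa [hz] at hν

/-- The identity behind `1 - ‖ψ s‖ ^ 2 = (6 - 2 * ‖s‖ ^ 2) / ‖3 - s‖ ^ 2` for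
`ψ s = √3 * (1 - s) / (3 - s)`. -/
theorem norm_three_sub_sq (s : ℂ) :
    3 * ‖1 - s‖ ^ 2 + (6 - 2 * ‖s‖ ^ 2) = ‖3 - s‖ ^ 2 := by
  simp only [← Complex.normSq_eq_norm_sq, Complex.normSq_apply, Complex.sub_re, Complex.sub_im,
    Complex.one_re, Complex.one_im, Complex.re_ofNat, Complex.im_ofNat]
  ring

/-- **Bonk's distortion theorem** for the derivative `h` of a normalised Bloch function, on the
positive radius. -/
theorem bonk_distortion_real {h : ℂ → ℂ} (hd : DifferentiableOn ℂ h (ball 0 1)) (h0 : h 0 = 1)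
    (hb : ∀ z ∈ ball (0 : ℂ) 1, (1 - ‖z‖ ^ 2) * ‖h z‖ ≤ 1) {t : ℝ} (ht0 : 0 ≤ t)
    (ht : t ≤ 1 / √3) :
    (1 - √3 * t) / (1 - 1 / √3 * t) ^ 3 ≤ (h t).re := by
  rcases ht0.eq_or_lt with rfl | htpos
  · simp [h0]
  have h3 : √3 * √3 = 3 := Real.mul_self_sqrt (by norm_num)
  have h3pos : 0 < √3 := by positivity
  have hn3 : ‖(√3 : ℂ)‖ ^ 2 = 3 := by
    rw [Complex.norm_real, Real.norm_eq_abs, sq_abs, sq, h3]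
  have hne : ∀ s : ℂ, ‖s‖ ≤ 1 → 3 - s ≠ 0 := by
    intro s hs h
    rw [← sub_eq_zero.1 h] at hs
    norm_num at hs
  -- `ψ` maps the unit disc onto a disc with `0 = ψ 1` on its boundary. For the extremal function,
  -- the `q` defined below is the identity.
  set ψ : ℂ → ℂ := fun s ↦ √3 * (1 - s) / (3 - s) with hψ
  have hψn : ∀ s : ℂ, ‖s‖ ≤ 1 →
      (1 - ‖ψ s‖ ^ 2) * ‖3 - s‖ ^ 2 = 6 - 2 * ‖s‖ ^ 2 := by
    intro s hs
    have hp := norm_pos_iff.2 (hne s hs)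
    simp only [hψ, norm_div, norm_mul, div_pow, mul_pow, hn3]
    have := norm_three_sub_sq s
    field_simp
    linarith
  have hψlt : ∀ s : ℂ, ‖s‖ ≤ 1 → ψ s ∈ ball (0 : ℂ) 1 := by
    intro s hs
    have hp := norm_pos_iff.2 (hne s hs)
    have := hψn s hs
    rw [mem_ball_zero_iff]
    by_contra hcon
    push Not at hcon
    have h1 : 1 - ‖ψ s‖ ^ 2 ≤ 0 := by nlinarith
    have h2 := mul_nonpos_of_nonpos_of_nonneg h1 (sq_nonneg ‖3 - s‖)
    nlinarith [norm_nonneg s]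
  have hψd : ∀ s : ℂ, ‖s‖ ≤ 1 → DifferentiableAt ℂ ψ s := fun s hs ↦
    (((differentiableAt_const _).sub differentiableAt_id).const_mul _).div
      ((differentiableAt_const _).sub differentiableAt_id) (hne s hs)
  set q : ℂ → ℂ := fun s ↦ 4 * h (ψ s) / (3 - s) ^ 2 with hq
  have hqd : ∀ s : ℂ, ‖s‖ ≤ 1 → DifferentiableAt ℂ q s := fun s hs ↦
    (((hd.differentiableAt (isOpen_ball.mem_nhds (hψlt s hs))).comp s (hψd s hs)).const_mul _).div
      (((differentiableAt_const _).sub differentiableAt_id).pow 2) (pow_ne_zero 2 (hne s hs))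
  have hqm : MapsTo q (ball 0 1) (ball 0 1) := by
    intro s hs
    rw [mem_ball_zero_iff] at hs ⊢
    have hp := norm_pos_iff.2 (hne s hs.le)
    have h1 := hb _ (hψlt s hs.le)
    have h2 := hψn s hs.le
    simp only [hq, norm_div, norm_mul, norm_pow]
    rw [div_lt_one (by positivity)]
    have hs2 : ‖s‖ ^ 2 < 1 := by nlinarith [norm_nonneg s]
    have h4 : (6 - 2 * ‖s‖ ^ 2) * ‖h (ψ s)‖ ≤ ‖3 - s‖ ^ 2 := by
      rw [← h2]; nlinarith [pow_pos hp 2]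
    have hn4 : ‖(4 : ℂ)‖ = 4 := by norm_num
    rw [hn4]
    rcases (norm_nonneg (h (ψ s))).eq_or_lt with h5 | h5
    · rw [← h5]; simpa using pow_pos hp 2
    · nlinarith
  have hq1 : q 1 = 1 := by simp [hq, hψ, h0]; norm_num
  have hqder : HasDerivAt (fun r : ℝ ↦ ‖q r‖ ^ 2) 2 1 := by
    have hν := hasDerivAt_norm_sq_zero hd h0 hb
    have hρ : HasDerivAt (fun r : ℝ ↦ √3 * (1 - r) / (3 - r)) (-√3 / 2) 1 := by
      have := (((hasDerivAt_id (1 : ℝ)).const_sub 1).const_mul √3).div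
        ((hasDerivAt_id (1 : ℝ)).const_sub 3) (by norm_num)
      convert! this using 1
      norm_num
      ring
    have hνρ : HasDerivAt (fun r : ℝ ↦ ‖h ((√3 * (1 - r) / (3 - r) : ℝ) : ℂ)‖ ^ 2) 0 1 := by
      have := HasDerivAt.comp (h₂ := fun t : ℝ ↦ ‖h t‖ ^ 2) (h₂' := 0) 1 (by simpa using hν) hρ
      rwa [zero_mul] at this
    have hden : HasDerivAt (fun r : ℝ ↦ (3 - r) ^ 4) (-32) 1 := by
      have := ((hasDerivAt_id (1 : ℝ)).const_sub 3).pow 4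
      convert! this using 1
      norm_num
    have := (hνρ.const_mul 16).div hden (by norm_num)
    convert! this using 1
    · funext r
      simp only [hq, hψ, norm_div, norm_mul, norm_pow, div_pow, mul_pow, Pi.div_apply]
      have e1 : ‖(3 : ℂ) - r‖ ^ 2 = (3 - r) ^ 2 := by
        rw [← Complex.ofReal_ofNat, ← Complex.ofReal_sub, Complex.norm_real, Real.norm_eq_abs,
          sq_abs]
      rw [e1]
      push_cast
      norm_num
      ring
    · norm_num [h0]
  -- the parameter with `ψ x = t`
  obtain ⟨v, hv⟩ : ∃ v, v = 1 / √3 * t := ⟨_, rfl⟩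
  have hv3 : √3 * v = t := by rw [hv]; field_simp
  have ht3 : √3 * t = 3 * v := by rw [← hv3, ← mul_assoc, h3]
  have hvpos : 0 < v := by rw [hv]; positivity
  have hv1 : 3 * v ≤ 1 := by
    rw [le_div_iff₀ h3pos] at ht; linarith
  have hdenpos : 0 < 1 - v := by linarith
  rw [ht3, ← hv]
  set x : ℝ := (1 - 3 * v) / (1 - v) with hx
  have hx0 : 0 ≤ x := div_nonneg (by linarith) hdenpos.le
  have hx1 : x < 1 := by
    rw [hx, div_lt_one hdenpos]
    linarith
  have hjul := le_re_of_boundary_deriv (fun s hs ↦ (hqd s (mem_ball_zero_iff.1 hs).le)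
    |>.differentiableWithinAt) hqm hq1 (hqd 1 (by simp)).continuousAt hqder
    (x := x) ⟨by linarith, hx1⟩
  have h3x : 3 - x = 2 / (1 - v) := by
    rw [hx]; field_simp; ring
  have h1x : 1 - x = 2 * v / (1 - v) := by
    rw [hx]; field_simp; ring
  have hψx : ψ x = t := by
    have hr : √3 * (1 - x) / (3 - x) = t := by
      rw [h3x, h1x, ← hv3]
      field_simp
    rw [hψ, ← hr]; push_cast; rfl
  have hqx : (q x).re = 4 * (h t).re / (3 - x) ^ 2 := by
    simp only [hq, hψx]
    have : (4 * h t / (3 - (x : ℂ)) ^ 2) = ((4 / (3 - x) ^ 2 : ℝ) : ℂ) * h t := by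
      push_cast; ring
    rw [this, Complex.re_ofReal_mul]
    ring
  rw [hqx, h3x, le_div_iff₀ (by positivity)] at hjul
  have : x * (2 / (1 - v)) ^ 2 = 4 * ((1 - 3 * v) / (1 - v) ^ 3) := by
    rw [hx]; field_simp; ring
  rw [this] at hjul
  linarith

/-- **Bonk's distortion theorem**: the derivative `h` of a normalised Bloch function satisfies
`h 0 = 1` and `‖h z‖ ≤ (1 - ‖z‖ ^ 2)⁻¹`, and its real part is then bounded below by the derivative
of the extremal function. -/
theorem bonk_distortion {h : ℂ → ℂ} (hd : DifferentiableOn ℂ h (ball 0 1)) (h0 : h 0 = 1)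
    (hb : ∀ z ∈ ball (0 : ℂ) 1, (1 - ‖z‖ ^ 2) * ‖h z‖ ≤ 1) {z : ℂ} (hz : ‖z‖ ≤ 1 / √3) :
    (1 - √3 * ‖z‖) / (1 - 1 / √3 * ‖z‖) ^ 3 ≤ (h z).re := by
  obtain ⟨c, hc, hcz⟩ : ∃ c : ℂ, ‖c‖ = 1 ∧ c * ‖z‖ = z := by
    rcases eq_or_ne z 0 with rfl | hz0
    · exact ⟨1, by simp, by simp⟩
    · have : (‖z‖ : ℂ) ≠ 0 := by exact_mod_cast norm_ne_zero_iff.2 hz0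
      exact ⟨z / ‖z‖, by simp [hz0], div_mul_cancel₀ _ this⟩
  have hmap : MapsTo (fun w : ℂ ↦ c * w) (ball 0 1) (ball 0 1) := by
    intro w hw
    simpa [hc] using hw
  have := bonk_distortion_real (h := fun w ↦ h (c * w))
    (hd.comp ((differentiable_const c).mul differentiable_id).differentiableOn hmap)
    (by simp [h0]) (fun w hw ↦ by simpa [hc] using hb _ (hmap hw)) (norm_nonneg z) hz
  simpa only [hcz] using this

/-! ### Growth, univalence and covering in one variable -/

/-- The extremal function of Bonk's distortion theorem on the positive radius, normalised by
`extremalGrowth 0 = 0`; its derivative is the lower bound in that theorem. -/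
noncomputable def extremalGrowth (t : ℝ) : ℝ := √3 * t * (√3 - 2 * t) / (√3 - t) ^ 2

theorem hasDerivAt_extremalGrowth {t : ℝ} (ht : t < √3) :
    HasDerivAt extremalGrowth ((1 - √3 * t) / (1 - 1 / √3 * t) ^ 3) t := by
  have h3 : √3 ^ 2 = 3 := Real.sq_sqrt (by norm_num)
  have hne : √3 - t ≠ 0 := by linarith
  have h3pos : √3 ≠ 0 := by positivity
  have := (((hasDerivAt_id t).const_mul √3).mul
    (((hasDerivAt_id t).const_mul 2).const_sub √3)).div
    (((hasDerivAt_id t).const_sub √3).pow 2) (pow_ne_zero 2 hne)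
  convert! this using 1
  have e : 1 - 1 / √3 * t = (√3 - t) / √3 := by field_simp
  rw [e]
  simp
  field_simp
  ring_nf
  rw [show √3 ^ 3 = √3 ^ 2 * √3 by ring, h3]
  ring

theorem inv_sqrt_three_lt_one : 1 / √3 < 1 := by
  rw [div_lt_one (by positivity)]
  exact Real.lt_sqrt_of_sq_lt (by norm_num)

theorem one_lt_sqrt_three : 1 < √3 := Real.lt_sqrt_of_sq_lt (by norm_num)

theorem extremal_derivative_pos {t : ℝ} (ht : t < 1 / √3) :
    0 < (1 - √3 * t) / (1 - 1 / √3 * t) ^ 3 := by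
  have h3pos : 0 < √3 := by positivity
  have h1 : 0 < 1 - √3 * t := by
    rw [lt_div_iff₀ h3pos] at ht; linarith
  have h2 : 0 < 1 - 1 / √3 * t := by
    have := (ht.trans inv_sqrt_three_lt_one).trans one_lt_sqrt_three
    rw [sub_pos, div_mul_eq_mul_div, one_mul, div_lt_one h3pos]
    exact this
  positivity

theorem extremalGrowth_pos {t : ℝ} (h0 : 0 < t) (ht : t < 1 / √3) : 0 < extremalGrowth t := by
  have h3 : √3 ^ 2 = 3 := Real.sq_sqrt (by norm_num)
  have h3pos : 0 < √3 := by positivity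
  have h1 : 0 < √3 - 2 * t := by
    rw [lt_div_iff₀ h3pos] at ht
    nlinarith
  have h2 : 0 < √3 - t := by linarith
  unfold extremalGrowth
  positivity

theorem extremalGrowth_inv_sqrt_three : extremalGrowth (1 / √3) = √3 / 4 := by
  have h3 : √3 ^ 2 = 3 := Real.sq_sqrt (by norm_num)
  unfold extremalGrowth
  have e : √3 - 1 / √3 = 2 / √3 := by field_simp; rw [h3]; norm_num
  have e2 : √3 - 2 * (1 / √3) = 1 / √3 := by field_simp; rw [h3]; norm_num
  rw [e, e2]
  field_simp
  norm_num

/-- Integrating a lower bound for `Re g'` along the radius through `z`. -/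
theorem extremalGrowth_le_norm {g : ℂ → ℂ} (hg : DifferentiableOn ℂ g (ball 0 (1 / √3)))
    (hg0 : g 0 = 0)
    (hre : ∀ z ∈ ball (0 : ℂ) (1 / √3),
      (1 - √3 * ‖z‖) / (1 - 1 / √3 * ‖z‖) ^ 3 ≤ (deriv g z).re)
    {z : ℂ} (hz : z ∈ ball (0 : ℂ) (1 / √3)) : extremalGrowth ‖z‖ ≤ ‖g z‖ := by
  rcases eq_or_ne z 0 with rfl | hz0
  · simp [extremalGrowth]
  have hzn : (‖z‖ : ℂ) ≠ 0 := by exact_mod_cast norm_ne_zero_iff.2 hz0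
  rw [mem_ball_zero_iff] at hz
  set c : ℂ := z / ‖z‖ with hc
  have hcn : ‖c‖ = 1 := by simp [hc, hz0]
  have hcc : conj c * c = 1 := by rw [Complex.conj_mul', hcn]; norm_num
  have hcz : (‖z‖ : ℂ) * c = z := mul_div_cancel₀ _ hzn
  have hmem : ∀ s ∈ Icc 0 ‖z‖, (s : ℂ) * c ∈ ball (0 : ℂ) (1 / √3) := by
    intro s hs
    rw [mem_ball_zero_iff, norm_mul, hcn, mul_one, Complex.norm_real, Real.norm_eq_abs,
      abs_of_nonneg hs.1]
    exact hs.2.trans_lt hz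
  have hder : ∀ s ∈ Icc 0 ‖z‖, HasDerivAt
      (fun s : ℝ ↦ (conj c * g (s * c)).re - extremalGrowth s)
      ((deriv g (s * c)).re - (1 - √3 * s) / (1 - 1 / √3 * s) ^ 3) s := by
    intro s hs
    have h1 : HasDerivAt g (deriv g (s * c)) (s * c) :=
      (hg.differentiableAt (isOpen_ball.mem_nhds (hmem s hs))).hasDerivAt
    have h2 : HasDerivAt (fun w : ℂ ↦ conj c * g (w * c)) (deriv g (s * c)) s := by
      have := (h1.comp (s : ℂ) ((hasDerivAt_id (s : ℂ)).mul_const c)).const_mul (conj c)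
      convert! this using 1
      rw [one_mul, mul_comm (deriv g _), ← mul_assoc, hcc, one_mul]
    exact h2.real_of_complex.sub (hasDerivAt_extremalGrowth
      (hs.2.trans_lt ((hz.trans inv_sqrt_three_lt_one).trans one_lt_sqrt_three)))
  have hmono : MonotoneOn (fun s : ℝ ↦ (conj c * g (s * c)).re - extremalGrowth s)
      (Icc 0 ‖z‖) := by
    refine monotoneOn_of_deriv_nonneg (convex_Icc _ _)
      (fun s hs ↦ (hder s hs).continuousAt.continuousWithinAt)
      (fun s hs ↦ (hder s (interior_subset hs)).differentiableAt.differentiableWithinAt) ?_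
    intro s hs
    have hs' := interior_subset hs
    rw [(hder s hs').deriv, sub_nonneg]
    have := hre _ (hmem s hs')
    rwa [norm_mul, hcn, mul_one, Complex.norm_real, Real.norm_eq_abs, abs_of_nonneg hs'.1] at this
  have h := hmono (left_mem_Icc.2 (norm_nonneg z)) (right_mem_Icc.2 (norm_nonneg z)) (norm_nonneg z)
  have h0 : extremalGrowth 0 = 0 := by simp [extremalGrowth]
  simp only [Complex.ofReal_zero, zero_mul, hg0, mul_zero, Complex.zero_re, h0, sub_zero,
    hcz] at h
  calc extremalGrowth ‖z‖ ≤ (conj c * g z).re := by linarith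
    _ ≤ ‖conj c * g z‖ := Complex.re_le_norm _
    _ = ‖g z‖ := by rw [norm_mul, RCLike.norm_conj, hcn, one_mul]

/-- The **Noshiro–Warschawski theorem**: a holomorphic function on a convex open set whose
derivative has positive real part is injective. -/
theorem injOn_of_re_deriv_pos {g : ℂ → ℂ} {U : Set ℂ} (hU : IsOpen U) (hconv : Convex ℝ U)
    (hg : DifferentiableOn ℂ g U) (hre : ∀ z ∈ U, 0 < (deriv g z).re) : InjOn g U := by
  intro a ha b hb hab
  by_contra hne
  have hba : b - a ≠ 0 := sub_ne_zero.2 (Ne.symm hne)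
  have hmem : ∀ s ∈ Icc (0 : ℝ) 1, a + s * (b - a) ∈ U := by
    intro s hs
    have := hconv.add_smul_sub_mem ha hb hs
    simpa using this
  have hder : ∀ s ∈ Icc (0 : ℝ) 1, HasDerivAt
      (fun s : ℝ ↦ (g (a + s * (b - a)) / (b - a)).re) (deriv g (a + s * (b - a))).re s := by
    intro s hs
    have h1 : HasDerivAt g (deriv g (a + s * (b - a))) (a + s * (b - a)) :=
      (hg.differentiableAt (hU.mem_nhds (hmem s hs))).hasDerivAt
    have h2 := (h1.comp (s : ℂ)
      (((hasDerivAt_id (s : ℂ)).mul_const (b - a)).const_add a)).div_const (b - a)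
    have h3 : HasDerivAt (fun w : ℂ ↦ g (a + w * (b - a)) / (b - a))
        (deriv g (a + s * (b - a))) s := by
      convert! h2 using 1
      field_simp
    exact h3.real_of_complex
  -- Along the segment, `Re (g / (b - a))` has derivative `Re g'`, so it cannot return to its value.
  have hmono : StrictMonoOn (fun s : ℝ ↦ (g (a + s * (b - a)) / (b - a)).re) (Icc 0 1) := by
    refine strictMonoOn_of_deriv_pos (convex_Icc _ _)
      (fun s hs ↦ (hder s hs).continuousAt.continuousWithinAt) ?_
    intro s hs
    have hs' := interior_subset hs
    rw [(hder s hs').deriv]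
    exact hre _ (hmem s hs')
  have := hmono (left_mem_Icc.2 zero_le_one) (right_mem_Icc.2 zero_le_one) one_pos
  simp [hab] at this

/-- If `‖g‖ ≥ ρ` on the circle of radius `r` and `g` is a local homeomorphism inside, the image of
the disc contains the disc of radius `ρ`: within that disc the image is open and relatively
closed. -/
theorem ball_subset_image_of_le_norm_sphere {g : ℂ → ℂ} {r ρ : ℝ} (hr : 0 < r)
    (hg : ContinuousOn g (closedBall 0 r)) (hd : DifferentiableOn ℂ g (ball 0 r)) (hg0 : g 0 = 0)
    (hne : ∀ z ∈ ball (0 : ℂ) r, deriv g z ≠ 0) (hρ : ∀ z ∈ sphere (0 : ℂ) r, ρ ≤ ‖g z‖) :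
    ball 0 ρ ⊆ g '' ball 0 r := by
  rcases le_or_gt ρ 0 with h | hρ0
  · rw [ball_eq_empty.2 h]; exact empty_subset _
  have hopen : IsOpen (g '' ball 0 r) := by
    rw [isOpen_iff_mem_nhds]
    rintro _ ⟨z, hz, rfl⟩
    have hs : HasStrictDerivAt g (deriv g z) z :=
      (hd.analyticAt (isOpen_ball.mem_nhds hz)).hasStrictDerivAt
    rw [← hs.map_nhds_eq (hne z hz)]
    exact image_mem_map (isOpen_ball.mem_nhds hz)
  refine (convex_ball (0 : ℂ) ρ).isPreconnected.subset_of_closure_inter_subset hopen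
    ⟨0, mem_ball_self hρ0, 0, mem_ball_self hr, hg0⟩ ?_
  rintro w ⟨hw, hwρ⟩
  have hcl : closure (g '' ball 0 r) ⊆ g '' closedBall 0 r :=
    closure_minimal (image_mono ball_subset_closedBall)
      ((isCompact_closedBall 0 r).image_of_continuousOn hg).isClosed
  obtain ⟨z, hz, rfl⟩ := hcl hw
  refine ⟨z, ?_, rfl⟩
  rcases (mem_closedBall.1 hz).lt_or_eq with h | h
  · exact h
  · exact absurd (hρ z h) (not_le.2 (mem_ball_zero_iff.1 hwρ))

/-- A holomorphic function fixing `0` whose derivative obeys Bonk's lower bound covers the disc of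
radius `√3 / 4`. -/
theorem ball_subset_image_of_bonk_bound {g : ℂ → ℂ}
    (hg : DifferentiableOn ℂ g (ball 0 (1 / √3))) (hg0 : g 0 = 0)
    (hre : ∀ z ∈ ball (0 : ℂ) (1 / √3),
      (1 - √3 * ‖z‖) / (1 - 1 / √3 * ‖z‖) ^ 3 ≤ (deriv g z).re) :
    ball 0 (√3 / 4) ⊆ g '' ball 0 (1 / √3) := by
  intro c hc
  rw [mem_ball_zero_iff, ← extremalGrowth_inv_sqrt_three] at hc
  have hcont : ContinuousAt extremalGrowth (1 / √3) := (hasDerivAt_extremalGrowth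
    (inv_sqrt_three_lt_one.trans one_lt_sqrt_three)).continuousAt
  have hpos : 0 < 1 / √3 := by positivity
  obtain ⟨r, hrc, hr0, hr⟩ := (((hcont.eventually (lt_mem_nhds hc)).filter_mono
    nhdsWithin_le_nhds).and (Ioo_mem_nhdsLT hpos)).exists
  have hsub : closedBall (0 : ℂ) r ⊆ ball 0 (1 / √3) := closedBall_subset_ball hr
  have hsub' := ball_subset_closedBall.trans hsub
  refine image_mono hsub' (ball_subset_image_of_le_norm_sphere hr0 (hg.continuousOn.mono hsub)
    (hg.mono hsub') hg0 (fun z hz h ↦ ?_) (ρ := extremalGrowth r) (fun z hz ↦ ?_)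
    (mem_ball_zero_iff.2 hrc))
  · have h1 := hre z (hsub' hz)
    have h2 := extremal_derivative_pos (mem_ball_zero_iff.1 (hsub' hz))
    rw [h, Complex.zero_re] at h1
    linarith
  · have := extremalGrowth_le_norm hg hg0 hre (hsub (sphere_subset_closedBall hz))
    rwa [mem_sphere_zero_iff_norm.1 hz] at this

/-! ### Holomorphic maps between Banach spaces -/

section Banach

variable {X Y : Type*} [NormedAddCommGroup X] [NormedSpace ℂ X]
  [NormedAddCommGroup Y] [NormedSpace ℂ Y]

/-- A Fréchet differentiable map on an open subset of a complex normed space is continuously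
differentiable: the Schwarz lemma bounds the derivative, first of the map and then of its
increments. -/
theorem continuousAt_fderiv_of_differentiableOn {F : X → Y} {U : Set X} (hU : IsOpen U)
    (hF : DifferentiableOn ℂ F U) {a : X} (ha : a ∈ U) : ContinuousAt (fderiv ℂ F) a := by
  obtain ⟨r, hr, hball⟩ : ∃ r > 0, ball a (3 * r) ⊆ U ∩ {x | dist (F x) (F a) < 1} := by
    have : U ∩ {x | dist (F x) (F a) < 1} ∈ 𝓝 a :=
      inter_mem (hU.mem_nhds ha) ((hF.continuousOn.continuousAt (hU.mem_nhds ha)).eventually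
        (ball_mem_nhds _ one_pos))
    obtain ⟨ε, hε, h⟩ := Metric.mem_nhds_iff.1 this
    exact ⟨ε / 3, by positivity, by convert! h using 2; ring⟩
  have hdiff : ∀ x ∈ ball a (3 * r), DifferentiableAt ℂ F x := fun x hx ↦
    hF.differentiableAt (hU.mem_nhds (hball hx).1)
  have hsub : ∀ x ∈ ball a (2 * r), ball x r ⊆ ball a (3 * r) := fun x hx ↦
    ball_subset_ball' (by linarith [mem_ball.1 hx])
  have hbound : ∀ x ∈ ball a (2 * r), ‖fderiv ℂ F x‖ ≤ 2 / r := by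
    intro x hx
    refine Complex.norm_fderiv_le_div_of_mapsTo_ball
      (fun y hy ↦ (hdiff y (hsub x hx hy)).differentiableWithinAt) (fun y hy ↦ ?_) hr
    have h1 : dist (F y) (F a) < 1 := (hball (hsub x hx hy)).2
    have h2 : dist (F x) (F a) < 1 := (hball (hsub x hx (mem_ball_self hr))).2
    rw [mem_closedBall]
    linarith [dist_triangle_right (F y) (F x) (F a)]
  have hlip : ∀ x ∈ ball a (2 * r), ∀ y ∈ ball a (2 * r), ‖F y - F x‖ ≤ 2 / r * ‖y - x‖ :=
    fun x hx y hy ↦ (convex_ball a (2 * r)).norm_image_sub_le_of_norm_fderiv_le (𝕜 := ℂ)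
      (fun z hz ↦ hdiff z (ball_subset_ball (by linarith) hz)) hbound hx hy
  -- The increment `w ↦ F (w + (x - a)) - F w` is small on `ball a r`, hence so is its derivative.
  refine continuousAt_of_locally_lipschitz hr (2 * (2 / r) / r) fun x hx ↦ ?_
  have hsh : ∀ w ∈ ball a r, w + (x - a) ∈ ball a (2 * r) := by
    intro w hw
    rw [mem_ball_iff_norm] at hw ⊢
    rw [dist_eq_norm] at hx
    calc ‖w + (x - a) - a‖ = ‖(w - a) + (x - a)‖ := by congr 1; abel
      _ ≤ ‖w - a‖ + ‖x - a‖ := norm_add_le _ _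
      _ < 2 * r := by linarith
  have h23 : ball a (2 * r) ⊆ ball a (3 * r) := ball_subset_ball (by linarith)
  have h12 : ball a r ⊆ ball a (2 * r) := ball_subset_ball (by linarith)
  set φ : X → Y := fun w ↦ F (w + (x - a)) - F w with hφ
  have hφd : ∀ w ∈ ball a r, HasFDerivAt φ (fderiv ℂ F (w + (x - a)) - fderiv ℂ F w) w := by
    intro w hw
    have h1 := (hdiff _ (h23 (hsh w hw))).hasFDerivAt
    exact ((hasFDerivAt_comp_add_right (x - a)).2 h1).sub (hdiff _ (h23 (h12 hw))).hasFDerivAt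
  have hφb : ∀ w ∈ ball a r, ‖φ w‖ ≤ 2 / r * ‖x - a‖ := by
    intro w hw
    have := hlip w (h12 hw) _ (hsh w hw)
    rwa [add_sub_cancel_left] at this
  have hfin : ‖fderiv ℂ φ a‖ ≤ (2 * (2 / r * ‖x - a‖)) / r := by
    refine Complex.norm_fderiv_le_div_of_mapsTo_ball
      (fun w hw ↦ (hφd w hw).differentiableAt.differentiableWithinAt) (fun w hw ↦ ?_) hr
    rw [mem_closedBall, dist_eq_norm]
    linarith [norm_sub_le (φ w) (φ a), hφb w hw, hφb a (mem_ball_self hr)]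
  rw [(hφd a (mem_ball_self hr)).fderiv, add_sub_cancel] at hfin
  rw [dist_eq_norm, dist_eq_norm]
  refine hfin.trans_eq ?_
  ring

/-- An injective holomorphic map between Banach spaces with invertible derivatives is
biholomorphic onto its image. -/
theorem isBiholomorphicOn_image [CompleteSpace X] {F : X → Y} {U : Set X}
    (hU : IsOpen U) (hF : DifferentiableOn ℂ F U) (hinj : InjOn F U)
    (hder : ∀ x ∈ U, ∃ e : X ≃L[ℂ] Y, fderiv ℂ F x = e) : IsBiholomorphicOn F U (F '' U) := by
  have hstrict : ∀ x ∈ U, ∃ e : X ≃L[ℂ] Y, HasStrictFDerivAt F (e : X →L[ℂ] Y) x := by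
    intro x hx
    obtain ⟨e, he⟩ := hder x hx
    refine ⟨e, he ▸ hasStrictFDerivAt_of_hasFDerivAt_of_continuousAt ?_
      (continuousAt_fderiv_of_differentiableOn hU hF hx)⟩
    filter_upwards [hU.mem_nhds hx] with y hy
    exact (hF.differentiableAt (hU.mem_nhds hy)).hasFDerivAt
  have hnhds : ∀ x ∈ U, map F (𝓝 x) = 𝓝 (F x) := fun x hx ↦ by
    obtain ⟨e, he⟩ := hstrict x hx
    exact he.map_nhds_eq_of_equiv
  have hleft : LeftInvOn (Function.invFunOn F U) F U := hinj.leftInvOn_invFunOn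
  have hVopen : IsOpen (F '' U) := by
    rw [isOpen_iff_mem_nhds]
    rintro _ ⟨x, hx, rfl⟩
    rw [← hnhds x hx]
    exact image_mem_map (hU.mem_nhds hx)
  refine ⟨hU, hVopen, hF, mapsTo_image F U, Function.invFunOn F U, ?_,
    fun y hy ↦ Function.invFunOn_mem hy, hleft, fun y hy ↦ Function.invFunOn_eq hy⟩
  rintro _ ⟨x, hx, rfl⟩
  obtain ⟨e, he⟩ := hstrict x hx
  have hcont : ContinuousAt (Function.invFunOn F U) (F x) := by
    rw [ContinuousAt, ← hnhds x hx, tendsto_map'_iff, hleft hx]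
    refine tendsto_id.congr' ?_
    filter_upwards [hU.mem_nhds hx] with y hy
    exact (hleft hy).symm
  refine DifferentiableAt.differentiableWithinAt
    (HasStrictFDerivAt.of_local_left_inverse (f' := e) hcont (by rwa [hleft hx])
      ?_).hasFDerivAt.differentiableAt
  filter_upwards [hVopen.mem_nhds (mem_image_of_mem F hx)] with y hy
  exact Function.invFunOn_eq hy

/-- The operator `h ↦ c h + l(h) x` is invertible as soon as `c` and its eigenvalue `c + l(x)`
at `x` do not vanish. -/
theorem exists_equiv_smul_id_add_smulRight {c : ℂ} {l : X →L[ℂ] ℂ} {x : X} (hc : c ≠ 0)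
    (hcl : c + l x ≠ 0) :
    ∃ e : X ≃L[ℂ] X, c • ContinuousLinearMap.id ℂ X + l.smulRight x = e := by
  refine ⟨ContinuousLinearEquiv.equivOfInverse (c • ContinuousLinearMap.id ℂ X + l.smulRight x)
    (c⁻¹ • (ContinuousLinearMap.id ℂ X - ((c + l x)⁻¹ • l).smulRight x)) ?_ ?_, ?_⟩
  · intro h
    simp only [add_apply, smul_apply,
      ContinuousLinearMap.id_apply, ContinuousLinearMap.smulRight_apply,
      sub_apply, map_add, map_smul, smul_eq_mul]
    match_scalars <;> field_simp
    ring
  · intro h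
    simp only [add_apply, smul_apply,
      ContinuousLinearMap.id_apply, ContinuousLinearMap.smulRight_apply,
      sub_apply, map_sub, map_smul, smul_eq_mul]
    match_scalars <;> field_simp
    ring
  · ext h; rfl

/-! ### Maps of the form `x ↦ f x • x` -/

theorem hasFDerivAt_of_eq_smul {F : X → X} {f : X → ℂ} (hf : DifferentiableOn ℂ f (ball 0 1))
    (hF : ∀ x ∈ ball (0 : X) 1, F x = f x • x) {x : X} (hx : x ∈ ball (0 : X) 1) :
    HasFDerivAt F (f x • ContinuousLinearMap.id ℂ X + (fderiv ℂ f x).smulRight x) x := by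
  have h := (hf.differentiableAt (isOpen_ball.mem_nhds hx)).hasFDerivAt.smul (hasFDerivAt_id x)
  refine h.congr_of_eventuallyEq ?_
  filter_upwards [isOpen_ball.mem_nhds hx] with y hy using hF y hy

theorem fderiv_apply_self_of_eq_smul {F : X → X} {f : X → ℂ}
    (hf : DifferentiableOn ℂ f (ball 0 1))
    (hF : ∀ x ∈ ball (0 : X) 1, F x = f x • x) {x : X} (hx : x ∈ ball (0 : X) 1) :
    fderiv ℂ F x x = (f x + fderiv ℂ f x x) • x := by
  rw [(hasFDerivAt_of_eq_smul hf hF hx).fderiv, add_smul]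
  simp

/-- The Bloch norm controls the radial multiplier `f x + Df(x) x`. -/
theorem radial_multiplier_bound {F : X → X} {f : X → ℂ} (hf : DifferentiableOn ℂ f (ball 0 1))
    (hf0 : f 0 = 1) (hF : ∀ x ∈ ball (0 : X) 1, F x = f x • x) (hB : blochNorm F ≤ 1) {x : X}
    (hx : x ∈ ball (0 : X) 1) : (1 - ‖x‖ ^ 2) * ‖f x + fderiv ℂ f x x‖ ≤ 1 := by
  rcases eq_or_ne x 0 with rfl | hx0
  · simp [hf0]
  have h1 : ENNReal.ofReal ((1 - ‖x‖ ^ 2) * (‖fderiv ℂ F x x‖ / ‖x‖)) ≤ 1 :=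
    ((le_iSup₂ (f := fun x (_ : x ∈ ball (0 : X) 1 \ {0}) ↦
      ENNReal.ofReal ((1 - ‖x‖ ^ 2) * (‖fderiv ℂ F x x‖ / ‖x‖))) x ⟨hx, hx0⟩).trans
      le_add_self).trans hB
  rwa [ENNReal.ofReal_le_one, fderiv_apply_self_of_eq_smul hf hF hx, norm_smul,
    mul_div_cancel_right₀ _ (norm_ne_zero_iff.2 hx0)] at h1

/-- Bonk's theorem along the complex line through a unit vector `u`; the restriction of
`x ↦ f x • x` to that line is `z ↦ z * f (z • u)`. -/
theorem slice_bonk_bound {f : X → ℂ} (hf : DifferentiableOn ℂ f (ball 0 1)) (hf0 : f 0 = 1)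
    (hb : ∀ x ∈ ball (0 : X) 1, (1 - ‖x‖ ^ 2) * ‖f x + fderiv ℂ f x x‖ ≤ 1) {u : X}
    (hu : ‖u‖ = 1) :
    DifferentiableOn ℂ (fun z : ℂ ↦ z * f (z • u)) (ball 0 1) ∧
    (∀ z ∈ ball (0 : ℂ) 1,
      deriv (fun z : ℂ ↦ z * f (z • u)) z = f (z • u) + fderiv ℂ f (z • u) (z • u)) ∧
    ∀ z : ℂ, ‖z‖ ≤ 1 / √3 → (1 - √3 * ‖z‖) / (1 - 1 / √3 * ‖z‖) ^ 3 ≤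
      (deriv (fun z : ℂ ↦ z * f (z • u)) z).re := by
  have hmem : ∀ z ∈ ball (0 : ℂ) 1, z • u ∈ ball (0 : X) 1 := by
    intro z hz
    simpa [norm_smul, hu] using hz
  have hder : ∀ z ∈ ball (0 : ℂ) 1, HasDerivAt (fun z : ℂ ↦ z * f (z • u))
      (f (z • u) + fderiv ℂ f (z • u) (z • u)) z := by
    intro z hz
    have h1 := (hf.differentiableAt (isOpen_ball.mem_nhds (hmem z hz))).hasFDerivAt
    have h2 : HasDerivAt (fun z : ℂ ↦ z • u) ((1 : ℂ) • u) z := (hasDerivAt_id z).smul_const u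
    have h3 := (hasDerivAt_id z).mul (h1.comp_hasDerivAt z h2)
    convert! h3 using 1
    simp
  have hdiff : DifferentiableOn ℂ (fun z : ℂ ↦ z * f (z • u)) (ball 0 1) := fun z hz ↦
    (hder z hz).differentiableAt.differentiableWithinAt
  refine ⟨hdiff, fun z hz ↦ (hder z hz).deriv, fun z hz ↦ ?_⟩
  refine bonk_distortion (hdiff.deriv isOpen_ball) ?_ (fun w hw ↦ ?_) hz
  · rw [(hder 0 (mem_ball_self one_pos)).deriv]
    simp [hf0]
  · rw [(hder w hw).deriv]
    have := hb _ (hmem w hw)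
    rwa [norm_smul, hu, mul_one] at this

theorem exists_unit_smul {x : X} (hx : x ≠ 0) : ∃ u : X, ‖u‖ = 1 ∧ (‖x‖ : ℂ) • u = x :=
  ⟨(‖x‖ : ℂ)⁻¹ • x, norm_smul_inv_norm (𝕜 := ℂ) hx,
    smul_inv_smul₀ (by exact_mod_cast norm_ne_zero_iff.2 hx) x⟩

theorem re_radial_multiplier_ge {f : X → ℂ} (hf : DifferentiableOn ℂ f (ball 0 1)) (hf0 : f 0 = 1)
    (hb : ∀ x ∈ ball (0 : X) 1, (1 - ‖x‖ ^ 2) * ‖f x + fderiv ℂ f x x‖ ≤ 1) {x : X}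
    (hx : ‖x‖ ≤ 1 / √3) :
    (1 - √3 * ‖x‖) / (1 - 1 / √3 * ‖x‖) ^ 3 ≤ (f x + fderiv ℂ f x x).re := by
  rcases eq_or_ne x 0 with rfl | hx0
  · simp [hf0]
  obtain ⟨u, hu, hux⟩ := exists_unit_smul hx0
  obtain ⟨-, h2, h3⟩ := slice_bonk_bound hf hf0 hb hu
  have hn : ‖(‖x‖ : ℂ)‖ = ‖x‖ := by simp
  have := h3 (‖x‖ : ℂ) (by rwa [hn])
  rwa [h2 _ (by rw [mem_ball_zero_iff, hn]; exact hx.trans_lt inv_sqrt_three_lt_one), hn,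
    hux] at this

/-- On each slice `‖z * f (z • u)‖` is bounded below by the positive extremal growth. -/
theorem multiplier_ne_zero {f : X → ℂ} (hf : DifferentiableOn ℂ f (ball 0 1)) (hf0 : f 0 = 1)
    (hb : ∀ x ∈ ball (0 : X) 1, (1 - ‖x‖ ^ 2) * ‖f x + fderiv ℂ f x x‖ ≤ 1) {x : X}
    (hx : x ∈ ball (0 : X) (1 / √3)) : f x ≠ 0 := by
  rcases eq_or_ne x 0 with rfl | hx0
  · simp [hf0]
  obtain ⟨u, hu, hux⟩ := exists_unit_smul hx0
  obtain ⟨h1, -, h3⟩ := slice_bonk_bound hf hf0 hb hu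
  intro hfx
  have hn : ‖(‖x‖ : ℂ)‖ = ‖x‖ := by simp
  rw [mem_ball_zero_iff] at hx
  have h4 := extremalGrowth_le_norm (h1.mono (ball_subset_ball inv_sqrt_three_lt_one.le))
    (by simp) (fun z hz ↦ h3 z (mem_ball_zero_iff.1 hz).le) (z := ‖x‖)
    (mem_ball_zero_iff.2 (by rwa [hn]))
  rw [hn, hux, hfx, mul_zero, norm_zero] at h4
  exact absurd (extremalGrowth_pos (norm_pos_iff.2 hx0) hx) (not_lt.2 h4)

theorem injOn_smul_self {f : X → ℂ} (hf : DifferentiableOn ℂ f (ball 0 1)) (hf0 : f 0 = 1)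
    (hb : ∀ x ∈ ball (0 : X) 1, (1 - ‖x‖ ^ 2) * ‖f x + fderiv ℂ f x x‖ ≤ 1) :
    InjOn (fun x ↦ f x • x) (ball (0 : X) (1 / √3)) := by
  intro x hx y hy hxy
  simp only at hxy
  have hfx := multiplier_ne_zero hf hf0 hb hx
  have hfy := multiplier_ne_zero hf hf0 hb hy
  rcases eq_or_ne x 0 with rfl | hx0
  · rw [smul_zero, eq_comm, smul_eq_zero] at hxy
    exact (hxy.resolve_left hfy).symm
  -- Both points lie on the complex line spanned by `x`.
  obtain ⟨u, hu, hux⟩ := exists_unit_smul hx0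
  obtain ⟨b, hbu⟩ : ∃ b : ℂ, b • u = y :=
    ⟨(f y)⁻¹ * f x * ‖x‖, by rw [mul_smul, hux, mul_smul, hxy, inv_smul_smul₀ hfy]⟩
  obtain ⟨h1, -, h3⟩ := slice_bonk_bound hf hf0 hb hu
  have hinj := injOn_of_re_deriv_pos isOpen_ball (convex_ball (0 : ℂ) (1 / √3))
    (h1.mono (ball_subset_ball inv_sqrt_three_lt_one.le)) (fun z hz ↦
      (extremal_derivative_pos (mem_ball_zero_iff.1 hz)).trans_le
        (h3 z (mem_ball_zero_iff.1 hz).le))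
  have hnb : ‖b‖ = ‖y‖ := by rw [← hbu, norm_smul, hu, mul_one]
  have hu0 : u ≠ 0 := by rintro rfl; simp at hu
  have hab : (‖x‖ : ℂ) = b := by
    refine hinj (by simpa using hx) (by rw [mem_ball_zero_iff, hnb]; simpa using hy) ?_
    refine smul_left_injective ℂ hu0 ?_
    simp only
    rw [hux, hbu, mul_comm, mul_smul, hux, mul_comm, mul_smul, hbu, hxy]
  rw [← hux, ← hbu, hab]

theorem ball_subset_image_smul_self {f : X → ℂ} (hf : DifferentiableOn ℂ f (ball 0 1))
    (hf0 : f 0 = 1)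
    (hb : ∀ x ∈ ball (0 : X) 1, (1 - ‖x‖ ^ 2) * ‖f x + fderiv ℂ f x x‖ ≤ 1) :
    ball 0 (√3 / 4) ⊆ (fun x ↦ f x • x) '' ball (0 : X) (1 / √3) := by
  intro y hy
  rcases eq_or_ne y 0 with rfl | hy0
  · exact ⟨0, mem_ball_self (by positivity), by simp⟩
  obtain ⟨u, hu, huy⟩ := exists_unit_smul hy0
  obtain ⟨h1, -, h3⟩ := slice_bonk_bound hf hf0 hb hu
  obtain ⟨z, hz, hzy⟩ := ball_subset_image_of_bonk_bound
    (h1.mono (ball_subset_ball inv_sqrt_three_lt_one.le)) (by simp)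
    (fun z hz ↦ h3 z (mem_ball_zero_iff.1 hz).le)
    (show (‖y‖ : ℂ) ∈ ball (0 : ℂ) (√3 / 4) by simpa using hy)
  refine ⟨z • u, by simpa [norm_smul, hu] using hz, ?_⟩
  simp only at hzy ⊢
  rw [smul_smul, mul_comm, hzy, huy]

end Banach

/-! ### The Bloch class -/

theorem ball_inv_sqrt_three_subset {X : Type*} [SeminormedAddCommGroup X] :
    ball (0 : X) (1 / √3) ⊆ ball 0 1 :=
  ball_subset_ball inv_sqrt_three_lt_one.le

section BlochClass

variable {X : Type*} [NormedAddCommGroup X] [NormedSpace ℂ X]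

theorem blochClass.differentiableOn {F : X → X} (hF : F ∈ blochClass X) :
    DifferentiableOn ℂ F (ball 0 1) := by
  obtain ⟨⟨f, hf, -, hFf⟩, -⟩ := hF
  exact fun x hx ↦ (hasFDerivAt_of_eq_smul hf hFf hx).differentiableAt.differentiableWithinAt

theorem blochClass.injOn {F : X → X} (hF : F ∈ blochClass X) :
    InjOn F (ball (0 : X) (1 / √3)) := by
  obtain ⟨⟨f, hf, hf0, hFf⟩, hB⟩ := hF
  exact (injOn_smul_self hf hf0 fun x hx ↦ radial_multiplier_bound hf hf0 hFf hB.le hx).congr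
    fun x hx ↦ (hFf x (ball_inv_sqrt_three_subset hx)).symm

theorem blochClass.ball_subset_image {F : X → X} (hF : F ∈ blochClass X) :
    ball 0 (√3 / 4) ⊆ F '' ball (0 : X) (1 / √3) := by
  obtain ⟨⟨f, hf, hf0, hFf⟩, hB⟩ := hF
  rw [image_congr fun x hx ↦ hFf x (ball_inv_sqrt_three_subset hx)]
  exact ball_subset_image_smul_self hf hf0 fun x hx ↦ radial_multiplier_bound hf hf0 hFf hB.le hx

theorem blochClass.exists_equiv_fderiv {F : X → X} (hF : F ∈ blochClass X) {x : X}
    (hx : x ∈ ball (0 : X) (1 / √3)) : ∃ e : X ≃L[ℂ] X, fderiv ℂ F x = e := by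
  obtain ⟨⟨f, hf, hf0, hFf⟩, hB⟩ := hF
  have hb : ∀ x ∈ ball (0 : X) 1, (1 - ‖x‖ ^ 2) * ‖f x + fderiv ℂ f x x‖ ≤ 1 :=
    fun x hx ↦ radial_multiplier_bound hf hf0 hFf hB.le hx
  rw [(hasFDerivAt_of_eq_smul hf hFf (ball_inv_sqrt_three_subset hx)).fderiv]
  refine exists_equiv_smul_id_add_smulRight (multiplier_ne_zero hf hf0 hb hx) fun h ↦ ?_
  have hx' := mem_ball_zero_iff.1 hx
  have h1 := re_radial_multiplier_ge hf hf0 hb hx'.le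
  rw [h, Complex.zero_re] at h1
  exact absurd (extremal_derivative_pos hx') (not_lt.2 h1)

theorem blochClass.isBiholomorphicOn_image [CompleteSpace X] {F : X → X} (hF : F ∈ blochClass X)
    {U : Set X} (hU : IsOpen U) (hsub : U ⊆ ball 0 (1 / √3)) : IsBiholomorphicOn F U (F '' U) :=
  _root_.isBiholomorphicOn_image hU
    ((blochClass.differentiableOn hF).mono (hsub.trans ball_inv_sqrt_three_subset))
    ((blochClass.injOn hF).mono hsub) fun _ hx ↦ blochClass.exists_equiv_fderiv hF (hsub hx)

/-- The ball of radius `√3 / 4` about `F 0 = 0` is schlicht: restrict `F` to the preimage of that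
ball in `ball 0 (1 / √3)`. -/
theorem blochClass.isSchlichtBall_zero [CompleteSpace X] {F : X → X} (hF : F ∈ blochClass X) :
    IsSchlichtBall F 0 (√3 / 4) := by
  have hF0 : F 0 = 0 := by
    obtain ⟨⟨f, -, -, hFf⟩, -⟩ := hF
    rw [hFf 0 (mem_ball_self one_pos), smul_zero]
  have hpos : 0 < √3 / 4 := by positivity
  have hU : IsOpen (ball (0 : X) (1 / √3) ∩ F ⁻¹' ball 0 (√3 / 4)) :=
    ((blochClass.differentiableOn hF).continuousOn.mono
      ball_inv_sqrt_three_subset).isOpen_inter_preimage isOpen_ball isOpen_ball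
  refine ⟨hpos, _, hU, inter_subset_left.trans ball_inv_sqrt_three_subset,
    ⟨mem_ball_self (by positivity), by simp [hF0]⟩, ?_⟩
  rw [hF0]
  have h := blochClass.isBiholomorphicOn_image hF hU inter_subset_left
  rwa [image_inter_preimage, inter_eq_right.2 (blochClass.ball_subset_image hF)] at h

theorem sqrt_three_div_four_le_schlichtRadius [CompleteSpace X] {F : X → X}
    (hF : F ∈ blochClass X) : ENNReal.ofReal (√3 / 4) ≤ schlichtRadius F :=
  (le_iSup₂ (f := fun r (_ : IsSchlichtBall F 0 r) ↦ ENNReal.ofReal r) (√3 / 4)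
    (blochClass.isSchlichtBall_zero hF)).trans
    (le_iSup₂ (f := fun a (_ : a ∈ ball (0 : X) 1) ↦ schlichtRadiusAt F a) 0
      (mem_ball_self one_pos))

theorem blochClass.le_re_fderiv_apply_self {F : X → X} (hF : F ∈ blochClass X) {x : X}
    (hx : ‖x‖ ≤ 1 / √3) {l : X →L[ℂ] ℂ} (hl : l x = ‖x‖) :
    (1 - √3 * ‖x‖) / (1 - 1 / √3 * ‖x‖) ^ 3 * ‖x‖ ≤ (l (fderiv ℂ F x x)).re := by
  obtain ⟨⟨f, hf, hf0, hFf⟩, hB⟩ := hF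
  have hx1 : x ∈ ball (0 : X) 1 := mem_ball_zero_iff.2 (hx.trans_lt inv_sqrt_three_lt_one)
  rw [fderiv_apply_self_of_eq_smul hf hFf hx1, map_smul, hl, smul_eq_mul, Complex.re_mul_ofReal]
  exact mul_le_mul_of_nonneg_right (re_radial_multiplier_ge hf hf0
    (fun y hy ↦ radial_multiplier_bound hf hf0 hFf hB.le hy) hx) (norm_nonneg x)

end BlochClass

theorem mainTheorem8 {X : Type*} [NormedAddCommGroup X] [NormedSpace ℂ X] [CompleteSpace X] :
    (∀ F ∈ blochClass X, ∀ x : X, 0 < ‖x‖ → ‖x‖ ≤ 1 / Real.sqrt 3 →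
      ∀ l ∈ supportFunctionals x,
        (1 - Real.sqrt 3 * ‖x‖) / (1 - 1 / Real.sqrt 3 * ‖x‖) ^ 3 * ‖x‖ ≤
          (l (fderiv ℂ F x x)).re) ∧
    ENNReal.ofReal (Real.sqrt 3 / 4) ≤ blochConstant X ∧
    (∀ F ∈ blochClass X,
      IsBiholomorphicOn F (ball 0 (1 / Real.sqrt 3)) (F '' ball 0 (1 / Real.sqrt 3)) ∧
      ball 0 (Real.sqrt 3 / 4) ⊆ F '' ball 0 (1 / Real.sqrt 3)) :=
  ⟨fun _ hF _ _ hx _ hl ↦ blochClass.le_re_fderiv_apply_self hF hx hl.1,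
    le_iInf₂ fun _ hF ↦ sqrt_three_div_four_le_schlichtRadius hF,
    fun _ hF ↦ ⟨blochClass.isBiholomorphicOn_image hF isOpen_ball subset_rfl,
      blochClass.ball_subset_image hF⟩⟩
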